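/- Let $K=\mathbb R$ or $K=\mathbb C$, let $n\ge 1$ be an integer, $j_0\in\mathbb Z$, $0<\sigma<r$ real, and $q\in[1,\infty]$. Let $\varphi:\mathbb R\to K$ be the mother scaling function of a compactly supported interpolating multiresolution analysis $(W_j)_{j\in\mathbb Z}$ of $C_u(\mathbb R,K)$, the Banach space of bounded uniformly continuous functions with the supremum norm. That is, $\varphi$ is continuous and compactly supported with $\varphi(k)=\delta_{k,0}$ for $k\in\mathbb Z$; the $W_j$ are closed subspaces of $C_u(\mathbb R,K)$ with $W_j\subset W_{j+1}$ and dense union; $f\in W_j\iff f(2\,\cdot)\in W_{j+1}$; and $W_0=\{\sum_{k\in\mathbb Z}a_k\varphi(\cdot-k): a\in\ell^\infty(\mathbb Z)\}$. Put $\psi(t)=\varphi(2t-1)$, $\psi_0=\varphi$, $\psi_1=\psi$, $\tilde\psi_0=\delta$ (evaluation at $0$), and $$\tilde\psi_1=\sum_{l\in\mathbb Z}(-1)^{l-1}h_{1-l}\,\delta(\cdot-l/2),\qquad h_m=\varphi(m/2).$$ For $s\in\{0,1\}^n$, $j\in\mathbb Z$, $k\in\mathbb Z^n$ let $$\psi_{s,j,k}(x)=\prod_{i=1}^n\psi_{s_i}(2^jx_i-k_i),\qquad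 \langle\tilde\psi_{s,j,k},g\rangle=\Big\langle\bigotimes_{i=1}^n\tilde\psi_{s_i},\; g\big(2^{-j}(\cdot+k)\big)\Big\rangle .$$ Thus $\langle\tilde\psi_{s,j,k},g\rangle$ is a finite linear combination of the values $g(2^{-j}(k+l/2))$, $l\in\mathbb Z^n$. The corresponding tensor product MRA of $C_u(\mathbb R^n,K)$ consists of the spaces $V_j=\{\sum_{k\in\mathbb Z^n}a_k\psi_{0,j,k}: a\in\ell^\infty(\mathbb Z^n)\}$, and its mother scaling function is $\varphi^{[n]}(x)=\prod_i\varphi(x_i)$. Let $$J(n,j_0)=\{(0,j_0,k):k\in\mathbb Z^n\}\cup\{(s,j,k): s\in\{0,1\}^n\setminus\{0\},\ j\ge j_0,\ k\in\mathbb Z^n\}.$$ Suppose that $\varphi^{[n]}$ belongs to the Hölder space $C^r(\mathbb R^n)$ (with $m=\lfloor r\rfloor$: bounded uniformly continuous derivatives up to order $m$, those of order $m$ satisfying a Hölder condition of exponent $r-m$). Let $f$ belong to the Besov space $B^\sigma_{\infty,q}(\mathbb R^n)$, that is, $f\in L^\infty(\mathbb R^n,K)$ and, with $m=\lfloor\sigma\rfloor+1$,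 $$\Big(\int_0^1\big(t^{-\sigma}\sup_{\|h\|\le t}\|\Delta_h^mf\|_{L^\infty}\big)^q\,\frac{dt}{t}\Big)^{1/q}<\infty$$ (with the essential supremum over $0<t<1$ of $t^{-\sigma}\sup_{\|h\|\le t}\|\Delta_h^mf\|_{L^\infty}$ in place of the integral expression if $q=\infty$). Then $f$ agrees almost everywhere with a bounded uniformly continuous function, and, identifying $f$ with this (unique) continuous representative, $$f(x)=\sum_{\alpha\in J(n,j_0)}\langle\tilde\psi_\alpha,f\rangle\,\psi_\alpha(x)\qquad\text{for every }x\in\mathbb R^n,$$ where the series converges absolutely at each point $x\in\mathbb R^n$. -/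

import Mathlib

open MeasureTheory Set
open scoped ENNReal BoundedContinuousFunction

/-! ### Interpolating multiresolution analyses and their tensor products -/

/-- `φ : ℝ → K` is the mother scaling function of the compactly supported interpolating
multiresolution analysis `(W j)` of `C_u(ℝ, K)`, the Banach space of bounded uniformly
continuous functions with the supremum norm (a closed subspace of `ℝ →ᵇ K`). -/
structure IsInterpolatingMRA {K : Type*} [RCLike K] (φ : ℝ → K)
    (W : ℤ → Submodule K (ℝ →ᵇ K)) : Prop where
  continuous_scaling : Continuous φ
  hasCompactSupport_scaling : HasCompactSupport φ
  /-- the interpolation property `φ(k) = δ_{k,0}` -/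
  interpolating : ∀ k : ℤ, φ k = if k = 0 then 1 else 0
  /-- each `W j` is a closed subspace of `C_u(ℝ, K)` -/
  uniformContinuous : ∀ j, ∀ f ∈ W j, UniformContinuous f
  isClosed : ∀ j, IsClosed (W j : Set (ℝ →ᵇ K))
  nested : ∀ j, W j ≤ W (j + 1)
  /-- the union of the `W j` is dense in `C_u(ℝ, K)` -/
  dense : ∀ f : ℝ →ᵇ K, UniformContinuous f → f ∈ closure (⋃ j, (W j : Set (ℝ →ᵇ K)))
  /-- `f ∈ W j ↔ f(2 ·) ∈ W (j + 1)` -/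
  dilation : ∀ j, ∀ f g : ℝ →ᵇ K, (∀ x, g x = f (2 * x)) → (f ∈ W j ↔ g ∈ W (j + 1))
  /-- `W 0` consists of the sums `∑ₖ aₖ φ(· - k)` with bounded coefficients; in particular it is
  invariant under integer translations -/
  mem_zero_iff : ∀ f : ℝ →ᵇ K, f ∈ W 0 ↔
    ∃ a : ℤ → K, (∃ C : ℝ, ∀ k, ‖a k‖ ≤ C) ∧ ∀ x, HasSum (fun k : ℤ => a k * φ (x - k)) (f x)

/-- The one-dimensional mother functions: `φ` for `b = 0`, and the interpolating mother wavelet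
`ψ(t) = φ(2t - 1)` for `b = 1`. -/
def motherFun {K : Type*} (φ : ℝ → K) (b : Fin 2) (t : ℝ) : K :=
  if b = 0 then φ t else φ (2 * t - 1)

/-- The tensor product wavelet `ψ_{s,j,k}(x) = ∏ᵢ ψ_{sᵢ}(2^j xᵢ - kᵢ)`, where `ψ₀ = φ`, `ψ₁ = ψ`.
For `s = 0` this is the scaling function `φ^{[n]}_{j,k}`. -/
noncomputable def tensorWavelet {K : Type*} [RCLike K] {n : ℕ} (φ : ℝ → K) (s : Fin n → Fin 2)
    (j : ℤ) (k : Fin n → ℤ) (x : EuclideanSpace ℝ (Fin n)) : K :=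
  ∏ i, motherFun φ (s i) ((2 : ℝ) ^ j * x i - k i)

/-- The mother scaling function `φ^{[n]} = φ ⊗ ⋯ ⊗ φ` on `ℝⁿ`. -/
noncomputable def tensorScaling {K : Type*} [RCLike K] (n : ℕ) (φ : ℝ → K)
    (x : EuclideanSpace ℝ (Fin n)) : K :=
  ∏ i, φ (x i)

/-- `(V j)` is the compactly supported interpolating tensor product MRA of `C_u(ℝⁿ, K)` generated
by `φ`: the function `φ` is the mother scaling function of a compactly supported interpolating MRA
of `C_u(ℝ, K)`, and `V j` consists of the sums `∑ₖ aₖ φ^{[n]}(2^j · - k)`, `k ∈ ℤⁿ`, with bounded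
coefficients. -/
structure IsTensorProductMRA {K : Type*} [RCLike K] {n : ℕ} (φ : ℝ → K)
    (V : ℤ → Submodule K (EuclideanSpace ℝ (Fin n) →ᵇ K)) : Prop where
  factor : ∃ W : ℤ → Submodule K (ℝ →ᵇ K), IsInterpolatingMRA φ W
  mem_iff : ∀ j, ∀ f : EuclideanSpace ℝ (Fin n) →ᵇ K, f ∈ V j ↔
    ∃ a : (Fin n → ℤ) → K, (∃ C : ℝ, ∀ k, ‖a k‖ ≤ C) ∧
      ∀ x, HasSum (fun k => a k * tensorWavelet φ 0 j k x) (f x)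

/-- Coefficients of the one-dimensional dual functionals `∑ₗ cₗ δ(· - l/2)`: the functional is
`δ` for `b = 0`, and for `b = 1` it is the dual mother wavelet, with `cₗ = (-1)^{l-1} h_{1-l}`,
where `hₘ = φ(m/2)` are the refinement coefficients of `φ(t) = ∑ₘ hₘ φ(2t - m)`. -/
noncomputable def dualFilter {K : Type*} [RCLike K] (φ : ℝ → K) (b : Fin 2) (l : ℤ) : K :=
  if b = 0 then (if l = 0 then 1 else 0) else (-1) ^ (l - 1) * φ ((1 - l) / 2)

/-- The value `⟨ψ̃_{s,j,k}, f⟩` of the dual tensor product wavelet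
`ψ̃_{s,j,k} = 2^{nj} (⊗ᵢ ψ̃_{sᵢ})(2^j · - k)` on a function `f`: a finite linear combination of
values `f(2^{-j}(k + l/2))`. For `s = 0` it is `f(2^{-j} k)`. -/
noncomputable def dualWavelet {K : Type*} [RCLike K] {n : ℕ} (φ : ℝ → K) (s : Fin n → Fin 2)
    (j : ℤ) (k : Fin n → ℤ) (f : EuclideanSpace ℝ (Fin n) → K) : K :=
  ∑ᶠ l : Fin n → ℤ, (∏ i, dualFilter φ (s i) (l i)) *
    f (WithLp.toLp 2 fun i => (2 : ℝ) ^ (-j) * (k i + l i / 2))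

/-- The index set of the wavelet expansion starting at level `j₀`: triples `(0, j₀, k)` and triples
`(s, j, k)` with `s ∈ {0,1}ⁿ ∖ {0}`, `j ≥ j₀`; always `k ∈ ℤⁿ`. -/
def waveletIndex (n : ℕ) (j₀ : ℤ) : Set ((Fin n → Fin 2) × ℤ × (Fin n → ℤ)) :=
  {α | (α.1 = 0 ∧ α.2.1 = j₀) ∨ (α.1 ≠ 0 ∧ j₀ ≤ α.2.1)}

/-! ### Hölder and Besov spaces -/

/-- Membership in the Hölder space `C^r(ℝⁿ)`, `r > 0`: with `m = ⌊r⌋`, all derivatives up to order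
`m` exist and are bounded and uniformly continuous, and those of order `m` satisfy a Hölder
condition with exponent `r - m ∈ [0, 1)`. -/
def MemHolderSpace {K : Type*} [RCLike K] {n : ℕ} (r : ℝ) (f : EuclideanSpace ℝ (Fin n) → K) : Prop :=
  ContDiff ℝ (⌊r⌋₊ : ℕ) f ∧
  (∀ i ≤ ⌊r⌋₊, UniformContinuous (iteratedFDeriv ℝ i f) ∧
    ∃ C : ℝ, ∀ x, ‖iteratedFDeriv ℝ i f x‖ ≤ C) ∧
  ∃ C : ℝ, ∀ x y, ‖iteratedFDeriv ℝ ⌊r⌋₊ f x - iteratedFDeriv ℝ ⌊r⌋₊ f y‖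
    ≤ C * ‖x - y‖ ^ (r - ⌊r⌋₊)

/-- The modulus of smoothness `ω_m(f; t)_p = sup_{‖h‖ ≤ t} ‖Δ_h^m f‖_{L^p}`. -/
noncomputable def modulusOfSmoothness {K : Type*} [RCLike K] {n : ℕ} (m : ℕ) (p : ℝ≥0∞)
    (f : EuclideanSpace ℝ (Fin n) → K) (t : ℝ) : ℝ≥0∞ :=
  ⨆ (h : EuclideanSpace ℝ (Fin n)) (_ : ‖h‖ ≤ t), eLpNorm ((fwdDiff h)^[m] f) p volume

/-- The Besov seminorm `(∫₀¹ (t^{-σ} ω_m(f; t)_p)^q dt/t)^{1/q}` (supremum if `q = ∞`), with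
`m = ⌊σ⌋ + 1`. -/
noncomputable def besovSeminorm {K : Type*} [RCLike K] {n : ℕ} (σ : ℝ) (p q : ℝ≥0∞)
    (f : EuclideanSpace ℝ (Fin n) → K) : ℝ≥0∞ :=
  eLpNorm (fun t : ℝ => ENNReal.ofReal (t ^ (-σ)) * modulusOfSmoothness (⌊σ⌋₊ + 1) p f t) q
    ((volume.restrict (Ioo (0 : ℝ) 1)).withDensity fun t => ENNReal.ofReal t⁻¹)

/-- `f` represents an element of the Besov space `B^σ_{p,q}(ℝⁿ)`, `σ > 0`, `1 ≤ p, q ≤ ∞`. -/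
def MemBesov {K : Type*} [RCLike K] {n : ℕ} (σ : ℝ) (p q : ℝ≥0∞)
    (f : EuclideanSpace ℝ (Fin n) → K) : Prop :=
  MemLp f p volume ∧ besovSeminorm σ p q f < ∞

/-!
The expansion converges because of Hölder continuity alone. It rests on three facts.

*Regularity.* Averaging the Besov condition over the scales `(t, 2t)` bounds the modulus of
smoothness by a multiple of `t ^ σ` (`exists_modulusOfSmoothness_le`). For functions defined
everywhere, Marchaud's inequality (`exists_norm_fwdDiff_le_of_iterate`) turns such a bound on
differences of high order into one on first differences, with a possibly smaller exponent
`β ∈ (0, 1)`. Its hypotheses hold, uniformly in the radius, for the means of `f` over small balls;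
a pointwise limit of these means is therefore a bounded `β`-Hölder function `g`, equal to `f` almost
everywhere (`MemBesov.exists_holder_representative`).

*Algebra.* Density of the union of the `W j` makes the integer translates of `φ` a partition of unity
(`IsInterpolatingMRA.hasSum_translates`), and `W 0 ⊆ W 1` gives the refinement equation
(`IsInterpolatingMRA.hasSum_refinement`). The latter decomposes `φ(2t - m)` into the functions
`φ(t - k)` and `ψ(t - k)` with the coefficients of the dual functionals. Taking tensor products,
the interpolant of `g` on the grid `2^{-(j+1)} ℤⁿ` is the interpolant on `2^{-j} ℤⁿ` plus the
wavelet terms of level `j` (`IsInterpolatingMRA.levelInterpolant_succ`), so the partial sums over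
levels telescope.

*Estimates.* By the partition of unity the interpolants converge to `g`
(`IsInterpolatingMRA.exists_norm_levelInterpolant_sub_le`), and the dual mother wavelet annihilates
constants, so that the coefficients of level `j` are `O(2^{-jβ})`
(`IsInterpolatingMRA.exists_norm_dualWavelet_le`). At a given point a bounded number of wavelets
of each level is nonzero, which gives absolute convergence.
-/

/-! ### Marchaud's inequality for bounded functions -/

section Marchaud

variable {E F : Type*} [NormedAddCommGroup E] [NormedAddCommGroup F]

/-- The symmetric sum `u(x + h) + u(x)`. It factors the difference of doubled step,
`Δ_{2h} = S_h Δ_h`, and `S_h - 2 = Δ_h`. -/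
def shiftSum (h : E) (u : E → F) (x : E) : F := u (x + h) + u x

lemma fwdDiff_add_self (h : E) (u : E → F) :
    fwdDiff (h + h) u = shiftSum h (fwdDiff h u) := by
  funext x
  simp only [fwdDiff, shiftSum, add_assoc]
  abel

lemma shiftSum_commute_fwdDiff (h : E) :
    Function.Commute (shiftSum h : (E → F) → E → F) (fwdDiff h) := by
  intro u
  funext x
  simp only [fwdDiff, shiftSum]
  abel

lemma fwdDiff_iterate_add_self (h : E) (m : ℕ) (u : E → F) :
    (fwdDiff (h + h))^[m] u = (shiftSum h)^[m] ((fwdDiff h)^[m] u) := by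
  have h1 : (fwdDiff (h + h) : (E → F) → E → F) = shiftSum h ∘ fwdDiff h := by
    funext u
    exact fwdDiff_add_self h u
  rw [h1, (shiftSum_commute_fwdDiff h).comp_iterate]
  rfl

lemma norm_fwdDiff_iterate_le (h : E) (m : ℕ) (u : E → F) (B : ℝ) (hB : ∀ x, ‖u x‖ ≤ B) (x : E) :
    ‖(fwdDiff h)^[m] u x‖ ≤ 2 ^ m * B := by
  induction m generalizing u B with
  | zero => simpa using hB x
  | succ m ih =>
    rw [Function.iterate_succ_apply, pow_succ, mul_assoc]
    refine ih _ _ fun y => ?_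
    rw [two_mul]
    exact (norm_sub_le _ _).trans (add_le_add (hB _) (hB _))

variable [NormedSpace ℝ F]

/-- The operator `S_h ^ m - 2 ^ m` is divisible by `S_h - 2 = Δ_h`, with a bounded quotient. -/
lemma norm_two_pow_smul_sub_shiftSum_iterate_le (h : E) (m : ℕ) (w : E → F) (e : ℝ)
    (he : ∀ y, ‖fwdDiff h w y‖ ≤ e) (x : E) :
    ‖(2 : ℝ) ^ m • w x - (shiftSum h)^[m] w x‖ ≤ (m * 2 ^ m : ℝ) * e := by
  induction m generalizing w e with
  | zero => simp
  | succ m ih =>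
    have he' : ∀ y, ‖fwdDiff h (shiftSum h w) y‖ ≤ 2 * e := fun y => by
      rw [← (shiftSum_commute_fwdDiff h) w, two_mul]
      exact (norm_add_le _ _).trans (add_le_add (he _) (he _))
    have h0 : 0 ≤ e := (norm_nonneg _).trans (he x)
    have h1 := ih (shiftSum h w) (2 * e) he'
    have h2 : (2 : ℝ) ^ (m + 1) • w x - (shiftSum h)^[m + 1] w x
        = ((2 : ℝ) ^ m • shiftSum h w x - (shiftSum h)^[m] (shiftSum h w) x)
          - (2 : ℝ) ^ m • fwdDiff h w x := by
      rw [Function.iterate_succ_apply]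
      simp only [fwdDiff, shiftSum, smul_add, smul_sub, pow_succ, mul_smul, two_smul]
      abel
    rw [h2]
    have h3 : ‖(2 : ℝ) ^ m • fwdDiff h w x‖ ≤ 2 ^ m * e := by
      rw [norm_smul, Real.norm_of_nonneg (by positivity)]
      gcongr
      exact he x
    have h4 : (0 : ℝ) ≤ 2 ^ m * e := by positivity
    refine (norm_sub_le _ _).trans ((add_le_add h1 h3).trans ?_)
    push_cast
    rw [pow_succ]
    nlinarith

variable [NormedSpace ℝ E]

/-- The constant is chosen so that the bound holds trivially for `‖h‖ ≥ 1` and passes from step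
`2h` to step `h` through `2 ^ m Δ_h ^ m = Δ_{2h} ^ m + O(Δ_h ^ (m + 1))`. -/
lemma norm_fwdDiff_iterate_le_of_succ {u : E → F} {B : ℝ} (hB : ∀ x, ‖u x‖ ≤ B) {β : ℝ}
    (hβ0 : 0 < β) (hβ1 : β < 1) {m : ℕ} (hm : 1 ≤ m) {C : ℝ}
    (hC : ∀ h x, ‖(fwdDiff h)^[m + 1] u x‖ ≤ C * ‖h‖ ^ β) (h x : E) :
    ‖(fwdDiff h)^[m] u x‖ ≤ (2 ^ m * B + m * C / (1 - 2 ^ (β - 1))) * ‖h‖ ^ β := by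
  have hB0 : 0 ≤ B := (norm_nonneg _).trans (hB 0)
  have hlt : (2 : ℝ) ^ (β - 1) < 1 :=
    Real.rpow_lt_one_of_one_lt_of_neg one_lt_two (by linarith)
  have hpos : 0 < 1 - (2 : ℝ) ^ (β - 1) := by linarith
  set A : ℝ := 2 ^ m * B + m * C / (1 - 2 ^ (β - 1)) with hA
  rcases eq_or_ne h 0 with rfl | h0
  · obtain ⟨k, rfl⟩ := Nat.exists_eq_succ_of_ne_zero (by omega : m ≠ 0)
    have : (fwdDiff (0 : E))^[k.succ] u x = 0 := by
      rw [Function.iterate_succ_apply']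
      simp [fwdDiff]
    rw [this, norm_zero, norm_zero, Real.zero_rpow hβ0.ne', mul_zero]
  have hC0 : 0 ≤ C := by
    have h1 := (norm_nonneg _).trans (hC h x)
    exact nonneg_of_mul_nonneg_left h1 (Real.rpow_pos_of_pos (norm_pos_iff.2 h0) _)
  have hAB : 2 ^ m * B ≤ A := le_add_of_nonneg_right (by positivity)
  have hA0 : 0 ≤ A := le_trans (by positivity) hAB
  have hmC : m * C ≤ A * (1 - 2 ^ (β - 1)) := by
    rw [hA, add_mul, div_mul_cancel₀ _ hpos.ne']
    exact le_add_of_nonneg_left (by positivity)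
  obtain ⟨k, hk⟩ : ∃ k : ℕ, 1 ≤ 2 ^ k * ‖h‖ := by
    obtain ⟨k, hk⟩ := pow_unbounded_of_one_lt ‖h‖⁻¹ (one_lt_two (α := ℝ))
    exact ⟨k, by
      have := mul_le_mul_of_nonneg_right hk.le (norm_nonneg h)
      rwa [inv_mul_cancel₀ (norm_ne_zero_iff.2 h0)] at this⟩
  clear h0
  induction k generalizing h x with
  | zero =>
    refine (norm_fwdDiff_iterate_le h m u B hB x).trans (hAB.trans ?_)
    exact le_mul_of_one_le_right hA0 (Real.one_le_rpow (by simpa using hk) hβ0.le)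
  | succ k ih =>
    have hn : ‖h + h‖ = 2 * ‖h‖ := by rw [← two_smul ℝ h, norm_smul]; simp
    have h1 := ih (h + h) x (by rw [hn, ← mul_assoc, ← pow_succ]; exact hk)
    rw [fwdDiff_iterate_add_self, hn, Real.mul_rpow two_pos.le (norm_nonneg _)] at h1
    have h2 := norm_two_pow_smul_sub_shiftSum_iterate_le h m ((fwdDiff h)^[m] u) (C * ‖h‖ ^ β)
      (fun y => by rw [← Function.iterate_succ_apply' (fwdDiff h)]; exact hC h y) x
    have h3 : (2 : ℝ) ^ m * ‖(fwdDiff h)^[m] u x‖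
        ≤ A * (2 ^ β * ‖h‖ ^ β) + (m * 2 ^ m) * (C * ‖h‖ ^ β) := by
      calc (2 : ℝ) ^ m * ‖(fwdDiff h)^[m] u x‖ = ‖(2 : ℝ) ^ m • (fwdDiff h)^[m] u x‖ := by
            rw [norm_smul, Real.norm_of_nonneg (by positivity)]
        _ ≤ _ := by
            rw [add_comm]
            exact (norm_le_norm_sub_add _ _).trans (add_le_add h2 h1)
    have h4 : (2 : ℝ) ^ β ≤ 2 ^ m * 2 ^ (β - 1) := by
      rw [Real.rpow_sub_one two_ne_zero]
      have : (2 : ℝ) ≤ 2 ^ m := by simpa using pow_le_pow_right₀ one_le_two hm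
      have := Real.rpow_pos_of_pos (two_pos (α := ℝ)) β
      rw [mul_div_assoc', le_div_iff₀ two_pos]
      nlinarith
    have hH : 0 ≤ ‖h‖ ^ β := by positivity
    refine le_of_mul_le_mul_left (h3.trans ?_) (by positivity : (0 : ℝ) < 2 ^ m)
    calc A * (2 ^ β * ‖h‖ ^ β) + (m * 2 ^ m) * (C * ‖h‖ ^ β)
        ≤ A * ((2 ^ m * 2 ^ (β - 1)) * ‖h‖ ^ β)
          + 2 ^ m * (A * (1 - 2 ^ (β - 1))) * ‖h‖ ^ β := by
          have : (m * 2 ^ m) * (C * ‖h‖ ^ β) = 2 ^ m * (m * C) * ‖h‖ ^ β := by ring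
          rw [this]
          gcongr
      _ = 2 ^ m * (A * ‖h‖ ^ β) := by ring

/-- **Marchaud's inequality**, for bounded functions and a Hölder exponent below one. The constant
depends on `u` only through its bound `B` and the constant `C`. -/
lemma exists_norm_fwdDiff_le_of_iterate (m : ℕ) (hm : 1 ≤ m) (B C : ℝ) {β : ℝ} (hβ0 : 0 < β)
    (hβ1 : β < 1) :
    ∃ C' : ℝ, ∀ u : E → F, (∀ x, ‖u x‖ ≤ B) →
      (∀ h x, ‖(fwdDiff h)^[m] u x‖ ≤ C * ‖h‖ ^ β) → ∀ h x, ‖fwdDiff h u x‖ ≤ C' * ‖h‖ ^ β := by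
  induction m, hm using Nat.le_induction generalizing C with
  | base => exact ⟨C, fun u _ hu => hu⟩
  | succ m hm ih =>
    obtain ⟨C', hC'⟩ := ih (2 ^ m * B + m * C / (1 - 2 ^ (β - 1)))
    exact ⟨C', fun u hB hu => hC' u hB (norm_fwdDiff_iterate_le_of_succ hB hβ0 hβ1 hm hu)⟩

end Marchaud

/-! ### Bounded functions with small higher differences have a Hölder continuous representative -/

section Representative

variable {K : Type*} [RCLike K] {n : ℕ}

/-- The mean of `f` over the ball of radius `ε` about `x`, written as an average of translates so
that it visibly commutes with differences. -/
noncomputable def ballMean (ε : ℝ) (f : EuclideanSpace ℝ (Fin n) → K)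
    (x : EuclideanSpace ℝ (Fin n)) : K :=
  ⨍ y in Metric.closedBall (0 : EuclideanSpace ℝ (Fin n)) ε, f (x + y)

lemma ballMean_eq (ε : ℝ) (f : EuclideanSpace ℝ (Fin n) → K) (x : EuclideanSpace ℝ (Fin n)) :
    ballMean ε f x = ⨍ y in Metric.closedBall x ε, f y := by
  have h := (measurePreserving_add_left (volume : Measure (EuclideanSpace ℝ (Fin n))) x)
  have hpre : (fun y => x + y) ⁻¹' Metric.closedBall x ε = Metric.closedBall 0 ε := by
    ext y; simp [dist_eq_norm]
  rw [ballMean, setAverage_eq, setAverage_eq, ← hpre,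
    h.setIntegral_preimage_emb (measurableEmbedding_addLeft x) f, measureReal_def,
    h.measure_preimage measurableSet_closedBall.nullMeasurableSet, ← measureReal_def]

lemma norm_ballMean_le {f : EuclideanSpace ℝ (Fin n) → K} {c : ℝ} (hc : 0 ≤ c)
    (hf : ∀ᵐ y, ‖f y‖ ≤ c) (ε : ℝ) (x : EuclideanSpace ℝ (Fin n)) : ‖ballMean ε f x‖ ≤ c := by
  have h := (measurePreserving_add_left (volume : Measure (EuclideanSpace ℝ (Fin n))) x)
  have h1 : ∀ᵐ y, ‖f (x + y)‖ ≤ c := h.quasiMeasurePreserving.ae hf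
  have hfin : volume (Metric.closedBall (0 : EuclideanSpace ℝ (Fin n)) ε) < ∞ :=
    measure_closedBall_lt_top
  have h2 := norm_setIntegral_le_of_norm_le_const_ae (f := fun y => f (x + y)) hfin
    (C := c) (ae_restrict_of_ae h1)
  rw [ballMean, setAverage_eq, norm_smul, Real.norm_of_nonneg (by positivity)]
  rcases eq_or_ne (volume.real (Metric.closedBall (0 : EuclideanSpace ℝ (Fin n)) ε)) 0 with h0 | h0
  · simpa [h0] using hc
  · calc _ ≤ _ := mul_le_mul_of_nonneg_left h2 (by positivity)
      _ = c := by field_simp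

lemma ae_norm_le_toReal_eLpNorm_top {f : EuclideanSpace ℝ (Fin n) → K}
    (hf : MemLp f ∞ volume) : ∀ᵐ x, ‖f x‖ ≤ (eLpNorm f ∞ volume).toReal := by
  filter_upwards [ae_le_eLpNormEssSup (f := f) (μ := volume)] with y hy
  rw [← eLpNorm_exponent_top] at hy
  rw [← toReal_enorm]
  exact (ENNReal.toReal_le_toReal (by simp) hf.2.ne).2 hy

lemma memLp_top_fwdDiff {f : EuclideanSpace ℝ (Fin n) → K} (hf : MemLp f ∞ volume)
    (h : EuclideanSpace ℝ (Fin n)) : MemLp (fwdDiff h f) ∞ volume :=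
  (hf.comp_measurePreserving (measurePreserving_add_right volume h)).sub hf

lemma integrableOn_translate_of_memLp_top {f : EuclideanSpace ℝ (Fin n) → K} (hf : MemLp f ∞ volume)
    (x : EuclideanSpace ℝ (Fin n)) (ε : ℝ) :
    IntegrableOn (fun y => f (x + y)) (Metric.closedBall 0 ε) volume := by
  have : IsFiniteMeasure (volume.restrict (Metric.closedBall (0 : EuclideanSpace ℝ (Fin n)) ε)) :=
    ⟨by simpa using measure_closedBall_lt_top⟩
  exact ((hf.comp_measurePreserving (measurePreserving_add_left volume x)).restrict _).integrable
    le_top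

lemma fwdDiff_ballMean {f : EuclideanSpace ℝ (Fin n) → K} (hf : MemLp f ∞ volume)
    (h : EuclideanSpace ℝ (Fin n)) (ε : ℝ) :
    fwdDiff h (ballMean ε f) = ballMean ε (fwdDiff h f) := by
  funext x
  simp only [fwdDiff, ballMean, setAverage_eq, add_right_comm x _ h]
  rw [integral_sub, smul_sub]
  · exact integrableOn_translate_of_memLp_top hf (x + h) ε
  · exact integrableOn_translate_of_memLp_top hf x ε

lemma fwdDiff_iterate_ballMean {f : EuclideanSpace ℝ (Fin n) → K} (hf : MemLp f ∞ volume)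
    (h : EuclideanSpace ℝ (Fin n)) (ε : ℝ) (m : ℕ) :
    (fwdDiff h)^[m] (ballMean ε f) = ballMean ε ((fwdDiff h)^[m] f) := by
  induction m generalizing f with
  | zero => rfl
  | succ m ih =>
    rw [Function.iterate_succ_apply, Function.iterate_succ_apply, fwdDiff_ballMean hf,
      ih (memLp_top_fwdDiff hf h)]

/-- The ball means of `f` are uniformly bounded and, by Marchaud's inequality, uniformly Hölder;
any pointwise limit of them along an ultrafilter is Hölder, and it is `f` almost everywhere by
Lebesgue's differentiation theorem. -/
lemma exists_holder_representative_of_fwdDiff_le {f : EuclideanSpace ℝ (Fin n) → K}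
    (hf : MemLp f ∞ volume)
    {β : ℝ} (hβ0 : 0 < β) (hβ1 : β < 1) {m : ℕ} (hm : 1 ≤ m) {C : ℝ} (hC0 : 0 ≤ C)
    (hC : ∀ h, ∀ᵐ x, ‖(fwdDiff h)^[m] f x‖ ≤ C * ‖h‖ ^ β) :
    ∃ (g : EuclideanSpace ℝ (Fin n) → K) (B C' : ℝ), (∀ x, ‖g x‖ ≤ B) ∧
      (∀ x y, ‖g x - g y‖ ≤ C' * ‖x - y‖ ^ β) ∧ g =ᵐ[volume] f := by
  set B : ℝ := (eLpNorm f ∞ volume).toReal with hBdef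
  have hB : ∀ᵐ y, ‖f y‖ ≤ B := ae_norm_le_toReal_eLpNorm_top hf
  obtain ⟨C', hC'⟩ := exists_norm_fwdDiff_le_of_iterate (E := EuclideanSpace ℝ (Fin n)) (F := K)
    m hm B C hβ0 hβ1
  set u : ℕ → EuclideanSpace ℝ (Fin n) → K := fun k => ballMean (1 / ((k : ℝ) + 1)) f with hu
  have hub : ∀ k x, ‖u k x‖ ≤ B := fun k x => norm_ballMean_le ENNReal.toReal_nonneg hB _ x
  have huh : ∀ k h x, ‖fwdDiff h (u k) x‖ ≤ C' * ‖h‖ ^ β := fun k => hC' (u k) (hub k) fun h x => by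
    rw [hu, fwdDiff_iterate_ballMean hf]
    exact norm_ballMean_le (by positivity) (hC h) _ x
  have hlim : ∀ x, ∃ a, Filter.Tendsto (fun k => u k x) (Filter.hyperfilter ℕ) (nhds a) := by
    intro x
    obtain ⟨a, -, ha⟩ := (isCompact_closedBall (0 : K) B).ultrafilter_le_nhds
      ((Filter.hyperfilter ℕ).map fun k => u k x)
      (by
        rw [Filter.le_principal_iff, Ultrafilter.mem_coe, Ultrafilter.mem_map]
        exact Filter.univ_mem' fun k => by simpa using hub k x)
    exact ⟨a, ha⟩
  choose g hg using hlim
  refine ⟨g, B, C', fun x => ?_, fun x y => ?_, ?_⟩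
  · exact le_of_tendsto (hg x).norm (Filter.Eventually.of_forall fun k => hub k x)
  · refine le_of_tendsto ((hg x).sub (hg y)).norm (Filter.Eventually.of_forall fun k => ?_)
    have := huh k (x - y) y
    rwa [fwdDiff, add_sub_cancel] at this
  · have hloc : LocallyIntegrable f volume := hf.locallyIntegrable le_top
    filter_upwards [IsUnifLocDoublingMeasure.ae_tendsto_average volume hloc 1] with x hx
    have h1 := hx (l := Filter.atTop) (fun _ : ℕ => x) (fun k => 1 / ((k : ℝ) + 1))
      (tendsto_nhdsWithin_iff.2 ⟨tendsto_one_div_add_atTop_nhds_zero_nat,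
        Filter.Eventually.of_forall fun k => by simp only [mem_Ioi]; positivity⟩)
      (Filter.Eventually.of_forall fun k => Metric.mem_closedBall_self (by positivity))
    refine tendsto_nhds_unique (hg x) ((h1.mono_left Nat.hyperfilter_le_atTop).congr fun k => ?_)
    exact (ballMean_eq _ f x).symm

/-- The Besov condition, averaged over the scales `(t, 2t)`, bounds the modulus of smoothness at
`t`, as the modulus is monotone. -/
lemma exists_modulusOfSmoothness_le {σ : ℝ} (hσ : 0 < σ) {q : ℝ≥0∞} (hq : 1 ≤ q)
    {f : EuclideanSpace ℝ (Fin n) → K} (hf : besovSeminorm σ ∞ q f < ∞) :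
    ∃ C : ℝ, 0 ≤ C ∧ ∀ t : ℝ, 0 < t → t ≤ 1 / 2 →
      modulusOfSmoothness (⌊σ⌋₊ + 1) ∞ f t ≤ ENNReal.ofReal (C * t ^ σ) := by
  set S := besovSeminorm σ ∞ q f with hS
  refine ⟨2 * 2 ^ σ * S.toReal, by positivity, fun t ht0 ht1 => ?_⟩
  set ω := modulusOfSmoothness (⌊σ⌋₊ + 1) ∞ f t with hω
  set ν : Measure ℝ :=
    (volume.restrict (Ioo (0 : ℝ) 1)).withDensity fun t => ENNReal.ofReal t⁻¹ with hν
  set c : ℝ≥0∞ := ENNReal.ofReal ((2 * t) ^ (-σ)) * ω with hc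
  -- the scales between `t` and `2t` have logarithmic measure at least `1/2`
  have hνt : ENNReal.ofReal (1 / 2) ≤ ν (Ioo t (2 * t)) := by
    rw [hν, withDensity_apply _ measurableSet_Ioo, Measure.restrict_restrict measurableSet_Ioo,
      inter_eq_left.2 (Ioo_subset_Ioo ht0.le (by linarith))]
    calc ENNReal.ofReal (1 / 2) = ∫⁻ _ in Ioo t (2 * t), ENNReal.ofReal (2 * t)⁻¹ := by
          rw [setLIntegral_const, Real.volume_Ioo, ← ENNReal.ofReal_mul (by positivity)]
          congr 1
          field_simp
          ring
      _ ≤ _ := by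
          refine setLIntegral_mono' measurableSet_Ioo fun s hs => ?_
          have := ht0.trans hs.1
          gcongr
          exact hs.2.le
  have hq' : 1 / q.toReal ≤ 1 := by
    rcases eq_or_ne q ∞ with rfl | hq1
    · simp
    · have : 1 ≤ q.toReal := by simpa using (ENNReal.toReal_le_toReal (by simp) hq1).2 hq
      rw [div_le_one (by linarith)]
      exact this
  have h1 : c * ENNReal.ofReal (1 / 2) ≤ S := by
    calc c * ENNReal.ofReal (1 / 2)
        ≤ c * ENNReal.ofReal (1 / 2) ^ (1 / q.toReal) := by
          gcongr
          calc ENNReal.ofReal (1 / 2) = ENNReal.ofReal (1 / 2) ^ (1 : ℝ) := by simp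
            _ ≤ _ := ENNReal.rpow_le_rpow_of_exponent_ge
                (ENNReal.ofReal_le_one.2 (by norm_num)) hq'
      _ ≤ c * ν (Ioo t (2 * t)) ^ (1 / q.toReal) := by gcongr
      _ = eLpNorm ((Ioo t (2 * t)).indicator fun _ => c) q ν := by
          rw [eLpNorm_indicator_const' measurableSet_Ioo, enorm_eq_self]
          · exact (lt_of_lt_of_le (by simp) hνt).ne'
          · exact (lt_of_lt_of_le (by simp) hq).ne'
      _ ≤ S := by
          refine eLpNorm_mono_enorm fun s => ?_
          by_cases hs : s ∈ Ioo t (2 * t)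
          · rw [indicator_of_mem hs, enorm_eq_self, enorm_eq_self, hc]
            have hs0 : 0 < s := ht0.trans hs.1
            refine mul_le_mul' (ENNReal.ofReal_le_ofReal ?_) ?_
            · exact Real.rpow_le_rpow_of_nonpos hs0 hs.2.le (by linarith)
            · exact iSup_mono fun h => iSup_mono' fun hh => ⟨hh.trans hs.1.le, le_rfl⟩
          · simp [indicator_of_notMem hs]
  have hpos : 0 < (2 * t) ^ (-σ) := by positivity
  have h2 : ENNReal.ofReal ((2 * t) ^ (-σ) * (1 / 2)) * ω ≤ S := by
    rw [ENNReal.ofReal_mul hpos.le, mul_right_comm]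
    exact h1
  have h3 : ω ≤ S / ENNReal.ofReal ((2 * t) ^ (-σ) * (1 / 2)) := by
    rw [ENNReal.le_div_iff_mul_le (Or.inl (by simpa using hpos)) (Or.inl ENNReal.ofReal_ne_top),
      mul_comm]
    exact h2
  refine h3.trans (le_of_eq ?_)
  rw [← ENNReal.ofReal_toReal hf.ne, ← ENNReal.ofReal_div_of_pos (by positivity),
    Real.rpow_neg (by positivity), Real.mul_rpow two_pos.le ht0.le,
    ENNReal.toReal_ofReal ENNReal.toReal_nonneg]
  congr 1
  field_simp

lemma ae_norm_fwdDiff_iterate_le {f : EuclideanSpace ℝ (Fin n) → K} {B : ℝ}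
    (hB : ∀ᵐ x, ‖f x‖ ≤ B) (h : EuclideanSpace ℝ (Fin n)) (m : ℕ) :
    ∀ᵐ x, ‖(fwdDiff h)^[m] f x‖ ≤ 2 ^ m * B := by
  induction m generalizing f B with
  | zero => simpa using hB
  | succ m ih =>
    simp only [Function.iterate_succ_apply, pow_succ, mul_assoc]
    refine ih ?_
    filter_upwards [hB, (measurePreserving_add_right (volume : Measure
      (EuclideanSpace ℝ (Fin n))) h).quasiMeasurePreserving.ae hB] with x hx hxh
    rw [two_mul]
    exact (norm_sub_le _ _).trans (add_le_add hxh hx)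

/-- The Besov condition gives a bound for all steps at an exponent below one: for small steps from
the modulus of smoothness, for large ones from the boundedness of `f`. -/
lemma exists_ae_norm_fwdDiff_iterate_le {σ : ℝ} (hσ : 0 < σ) {q : ℝ≥0∞} (hq : 1 ≤ q)
    {f : EuclideanSpace ℝ (Fin n) → K} (hf : MemBesov σ ∞ q f) :
    ∃ C : ℝ, 0 ≤ C ∧ ∀ h, ∀ᵐ x,
      ‖(fwdDiff h)^[⌊σ⌋₊ + 1] f x‖ ≤ C * ‖h‖ ^ (min σ (1 / 2)) := by
  obtain ⟨C, hC0, hC⟩ := exists_modulusOfSmoothness_le hσ hq hf.2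
  set m := ⌊σ⌋₊ + 1 with hm
  have hmem : ∀ h : EuclideanSpace ℝ (Fin n), ∀ k, MemLp ((fwdDiff h)^[k] f) ∞ volume := by
    intro h k
    induction k with
    | zero => exact hf.1
    | succ k ih => rw [Function.iterate_succ_apply']; exact memLp_top_fwdDiff ih h
  set β := min σ (1 / 2) with hβ
  have hβ0 : 0 < β := lt_min hσ (by norm_num)
  have hβ1 : β ≤ 1 := (min_le_right _ _).trans (by norm_num)
  set B := (eLpNorm f ∞ volume).toReal with hB
  have hB0 : 0 ≤ B := ENNReal.toReal_nonneg
  refine ⟨C + 2 * (2 ^ m * B), by positivity, fun h => ?_⟩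
  rcases eq_or_ne h 0 with rfl | h0
  · refine Filter.Eventually.of_forall fun x => ?_
    rw [hm, Function.iterate_succ_apply']
    simp [fwdDiff, Real.zero_rpow hβ0.ne']
  have hpos : 0 < ‖h‖ := norm_pos_iff.2 h0
  rcases le_or_gt ‖h‖ (1 / 2) with hle | hgt
  · filter_upwards [ae_norm_le_toReal_eLpNorm_top (hmem h m)] with x hx
    have h1 : eLpNorm ((fwdDiff h)^[m] f) ∞ volume ≤ ENNReal.ofReal (C * ‖h‖ ^ σ) := by
      refine le_trans ?_ (hC ‖h‖ hpos hle)
      rw [modulusOfSmoothness]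
      exact le_iSup₂_of_le h le_rfl le_rfl
    refine hx.trans ((ENNReal.toReal_le_of_le_ofReal (by positivity) h1).trans ?_)
    have h2 : ‖h‖ ^ σ ≤ ‖h‖ ^ β :=
      Real.rpow_le_rpow_of_exponent_ge hpos (by linarith) (min_le_left _ _)
    have : 0 ≤ 2 * (2 ^ m * B) * ‖h‖ ^ β := by positivity
    nlinarith
  · filter_upwards [ae_norm_fwdDiff_iterate_le (ae_norm_le_toReal_eLpNorm_top hf.1) h m] with x hx
    have h1 : 1 / 2 ≤ ‖h‖ ^ β :=
      calc (1 / 2 : ℝ) = (1 / 2) ^ (1 : ℝ) := by simp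
        _ ≤ (1 / 2) ^ β := Real.rpow_le_rpow_of_exponent_ge (by norm_num) (by norm_num) hβ1
        _ ≤ ‖h‖ ^ β := Real.rpow_le_rpow (by norm_num) hgt.le hβ0.le
    refine hx.trans ?_
    have h2 : 0 ≤ C * ‖h‖ ^ β := by positivity
    have h3 : 0 ≤ 2 ^ m * B := by positivity
    nlinarith

lemma MemBesov.exists_holder_representative {σ : ℝ} (hσ : 0 < σ) {q : ℝ≥0∞} (hq : 1 ≤ q)
    {f : EuclideanSpace ℝ (Fin n) → K} (hf : MemBesov σ ∞ q f) :
    ∃ (g : EuclideanSpace ℝ (Fin n) → K) (B C β : ℝ), 0 < β ∧ (∀ x, ‖g x‖ ≤ B) ∧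
      (∀ x y, ‖g x - g y‖ ≤ C * ‖x - y‖ ^ β) ∧ g =ᵐ[volume] f := by
  obtain ⟨C, hC0, hC⟩ := exists_ae_norm_fwdDiff_iterate_le hσ hq hf
  obtain ⟨g, B, C', h⟩ := exists_holder_representative_of_fwdDiff_le hf.1 (lt_min hσ (by norm_num))
    ((min_le_right σ (1 / 2)).trans_lt (by norm_num)) (Nat.le_add_left 1 _) hC0 hC
  exact ⟨g, B, C', _, lt_min hσ (by norm_num), h⟩

end Representative

/-! ### One-dimensional interpolating multiresolution analyses -/

section OneDim

variable {K : Type*} [RCLike K] {φ : ℝ → K}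

/-- A window of `2R + 2` integers about `y` that contains all `k` with `|y - k| < R`. -/
noncomputable def intWindow (R : ℕ) (y : ℝ) : Finset ℤ := Finset.Icc (⌊y⌋ - R) (⌊y⌋ + R + 1)

lemma le_abs_sub_of_notMem_intWindow {R : ℕ} {y : ℝ} {k : ℤ} (hk : k ∉ intWindow R y) :
    (R : ℝ) ≤ |y - k| := by
  rw [intWindow, Finset.mem_Icc, not_and_or, not_le, not_le] at hk
  rcases hk with hk | hk
  · have h1 : ((k + R : ℤ) : ℝ) ≤ ⌊y⌋ := by exact_mod_cast (by omega)
    have h2 := Int.floor_le y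
    push_cast at h1
    exact le_trans (by linarith) (le_abs_self _)
  · have h1 : ((⌊y⌋ + R + 1 : ℤ) : ℝ) ≤ k := by exact_mod_cast hk.le
    have h2 := Int.lt_floor_add_one y
    push_cast at h1
    exact le_trans (by linarith) (neg_le_abs _)

lemma card_intWindow (R : ℕ) (y : ℝ) : (intWindow R y).card = 2 * R + 2 := by
  rw [intWindow, Int.card_Icc]
  omega

namespace IsInterpolatingMRA

variable {W : ℤ → Submodule K (ℝ →ᵇ K)}

lemma exists_forall_le_abs (hW : IsInterpolatingMRA φ W) :
    ∃ R : ℕ, 1 ≤ R ∧ ∀ t : ℝ, (R : ℝ) ≤ |t| → φ t = 0 := by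
  obtain ⟨r, hr⟩ := hW.hasCompactSupport_scaling.isCompact.isBounded.subset_ball 0
  obtain ⟨N, hN⟩ := exists_nat_ge (max r 1)
  refine ⟨N, by exact_mod_cast (le_max_right r 1).trans hN, fun t ht => ?_⟩
  by_contra hne
  have h1 := hr (subset_tsupport φ hne)
  rw [Metric.mem_ball, dist_zero_right, Real.norm_eq_abs] at h1
  exact absurd (((le_max_left r 1).trans hN).trans ht) (not_le.2 h1)

lemma exists_norm_le (hW : IsInterpolatingMRA φ W) : ∃ B : ℝ, ∀ t, ‖φ t‖ ≤ B :=
  hW.hasCompactSupport_scaling.exists_bound_of_continuous hW.continuous_scaling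

/-- A function in `W 0` is interpolated by its values at the integers. -/
lemma hasSum_of_mem_zero (hW : IsInterpolatingMRA φ W) {f : ℝ →ᵇ K} (hf : f ∈ W 0) (x : ℝ) :
    HasSum (fun k : ℤ => f k * φ (x - k)) (f x) := by
  obtain ⟨a, -, ha⟩ := (hW.mem_zero_iff f).1 hf
  have key : ∀ m : ℤ, f m = a m := fun m => by
    refine (ha m).unique ?_
    convert hasSum_ite_eq m (a m) using 2 with k
    rw [← Int.cast_sub, hW.interpolating]
    by_cases h : k = m
    · simp [h]
    · rw [if_neg (by omega), if_neg h, mul_zero]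
  simpa only [key] using ha x

/-- A function in `W j`, `j ≥ 0`, is interpolated by its values on the grid `2⁻ʲ ℤ`. -/
lemma hasSum_of_mem (hW : IsInterpolatingMRA φ W) (j : ℕ) {f : ℝ →ᵇ K} (hf : f ∈ W j) (x : ℝ) :
    HasSum (fun k : ℤ => f (k / 2 ^ j) * φ (2 ^ j * x - k)) (f x) := by
  induction j generalizing f x with
  | zero => simpa using hW.hasSum_of_mem_zero hf x
  | succ j ih =>
    set f' : ℝ →ᵇ K := f.compContinuous ⟨fun y => y / 2, by fun_prop⟩ with hf'
    have h1 : f' ∈ W j := (hW.dilation j f' f fun y => by simp [hf']).2 (by exact_mod_cast hf)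
    have h2 := ih h1 (2 * x)
    simp only [hf', BoundedContinuousFunction.compContinuous_apply, ContinuousMap.coe_mk] at h2
    rw [mul_div_cancel_left₀ x two_ne_zero] at h2
    convert h2 using 4
    · rw [pow_succ, div_div]
    · rw [pow_succ]; ring

/-- The refinement equation `φ(t) = ∑ₘ hₘ φ(2t - m)`, `hₘ = φ(m/2)`. -/
lemma hasSum_refinement (hW : IsInterpolatingMRA φ W) (t : ℝ) :
    HasSum (fun m : ℤ => φ (m / 2) * φ (2 * t - m)) (φ t) := by
  obtain ⟨B, hB⟩ := hW.exists_norm_le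
  set f : ℝ →ᵇ K := BoundedContinuousFunction.ofNormedAddCommGroup φ hW.continuous_scaling B hB
    with hf
  have h0 : f ∈ W 0 := by
    refine (hW.mem_zero_iff f).2 ⟨fun k => if k = 0 then 1 else 0, ⟨1, fun k => ?_⟩, fun x => ?_⟩
    · by_cases hk : k = 0 <;> simp [hk]
    · change HasSum _ (φ x)
      convert hasSum_ite_eq (0 : ℤ) (φ x) using 2 with k
      by_cases hk : k = 0 <;> simp [hk]
  have h1 : f ∈ W (1 : ℕ) := by simpa using hW.nested 0 h0
  simpa [hf] using hW.hasSum_of_mem 1 h1 t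

/-- The integer translates of `φ` form a partition of unity: elements of `⋃ W j` are reproduced by
sampling, sampling is bounded in the supremum norm, and the constant `1` is in the closure of
`⋃ W j`. -/
lemma hasSum_translates (hW : IsInterpolatingMRA φ W) (y : ℝ) :
    HasSum (fun k : ℤ => φ (y - k)) 1 := by
  obtain ⟨R, -, hR⟩ := hW.exists_forall_le_abs
  have hsum : ∀ (a : ℤ → K) (z : ℝ), HasSum (fun k : ℤ => a k * φ (z - k))
      (∑ k ∈ intWindow R z, a k * φ (z - k)) := fun a z =>
    hasSum_sum_of_ne_finset_zero fun k hk => by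
      rw [hR _ (le_abs_sub_of_notMem_intWindow hk), mul_zero]
  obtain ⟨B, hB⟩ := hW.exists_norm_le
  have hB0 : 0 ≤ B := (norm_nonneg _).trans (hB 0)
  set M : ℝ := 1 + ((2 * R + 2 : ℕ) : ℝ) * B with hM
  have hM0 : 0 < M := by positivity
  suffices h : ∑ k ∈ intWindow R y, φ (y - k) = 1 by simpa [h] using hsum 1 y
  refine eq_of_forall_dist_le fun ε hε => ?_
  have hone : UniformContinuous (BoundedContinuousFunction.const ℝ (1 : K)) :=
    uniformContinuous_const
  obtain ⟨f, hf, hfd⟩ := Metric.mem_closure_iff.1 (hW.dense _ hone) (ε / M) (by positivity)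
  obtain ⟨i, hi⟩ := mem_iUnion.1 hf
  have hmono : Monotone W := monotone_int_of_le_succ hW.nested
  have hi' : f ∈ W (i.toNat : ℤ) := hmono (Int.self_le_toNat i) hi
  set j := i.toNat with hj
  have hpt : ∀ x, ‖1 - f x‖ ≤ ε / M := fun x => by
    rw [← dist_eq_norm]
    exact (BoundedContinuousFunction.dist_coe_le_dist x).trans hfd.le
  have h1 := hW.hasSum_of_mem j hi' (y / 2 ^ j)
  rw [mul_div_cancel₀ y (by positivity)] at h1
  have h2 := h1.unique (hsum (fun k : ℤ => f (k / 2 ^ j)) y)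
  have h3 : ∑ k ∈ intWindow R y, φ (y - k) - 1
      = ∑ k ∈ intWindow R y, (1 - f (k / 2 ^ j)) * φ (y - k) - (1 - f (y / 2 ^ j)) := by
    rw [h2]
    simp only [sub_mul, one_mul, Finset.sum_sub_distrib]
    ring
  rw [dist_eq_norm, h3]
  calc _ ≤ ((2 * R + 2 : ℕ) : ℝ) * (ε / M * B) + ε / M := by
        refine (norm_sub_le _ _).trans (add_le_add ?_ (hpt _))
        rw [← card_intWindow R y, ← nsmul_eq_mul]
        refine (norm_sum_le _ _).trans (Finset.sum_le_card_nsmul _ _ _ fun k _ => ?_)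
        rw [norm_mul]
        exact mul_le_mul (hpt _) (hB _) (norm_nonneg _) (by positivity)
    _ = ε := by rw [hM]; field_simp; ring

end IsInterpolatingMRA

/-- A sum over `ℤ` splits into the sums over the even and the odd integers. -/
lemma HasSum.int_even_add_odd {f : ℤ → K} {a b : K} (he : HasSum (fun k => f (2 * k)) a)
    (ho : HasSum (fun k => f (2 * k + 1)) b) : HasSum f (a + b) := by
  have h1 : Function.Injective fun k : ℤ => 2 * k := fun a b h => by simpa using h
  have h2 : Function.Injective fun k : ℤ => 2 * k + 1 := fun a b h => by simpa using h
  refine HasSum.add_isCompl (s := range fun k : ℤ => 2 * k) (t := range fun k : ℤ => 2 * k + 1)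
    ?_ ((h1.hasSum_range_iff).2 he) ((h2.hasSum_range_iff).2 ho)
  have h3 : range (fun k : ℤ => 2 * k) = {n | Even n} :=
    Set.ext fun x => ⟨fun ⟨k, hk⟩ => ⟨k, by rw [← hk]; ring⟩, fun ⟨k, hk⟩ => ⟨k, by rw [hk]; ring⟩⟩
  have h4 : range (fun k : ℤ => 2 * k + 1) = {n | Odd n} :=
    Set.ext fun x => ⟨fun ⟨k, hk⟩ => ⟨k, hk.symm⟩, fun ⟨k, hk⟩ => ⟨k, hk.symm⟩⟩
  rw [h3, h4]
  exact Int.isCompl_even_odd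

section DualFilter

lemma dualFilter_one_even (φ : ℝ → K) (k : ℤ) : dualFilter φ 1 (2 * k) = -φ (1 / 2 - k) := by
  have h : Odd (2 * k - 1) := ⟨k - 1, by ring⟩
  rw [dualFilter, if_neg (by decide), h.neg_one_zpow, neg_one_mul]
  congr 2
  push_cast
  ring

variable {W : ℤ → Submodule K (ℝ →ᵇ K)}

namespace IsInterpolatingMRA

lemma dualFilter_one_odd (hW : IsInterpolatingMRA φ W) (k : ℤ) :
    dualFilter φ 1 (2 * k + 1) = if k = 0 then 1 else 0 := by
  have h : Even (2 * k + 1 - 1) := ⟨k, by ring⟩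
  rw [dualFilter, if_neg (by decide), h.neg_one_zpow, one_mul]
  have h1 : ((1 : ℝ) - ((2 * k + 1 : ℤ) : ℝ)) / 2 = ((-k : ℤ) : ℝ) := by push_cast; ring
  rw [h1, hW.interpolating]
  simp

/-- The dual mother wavelet annihilates constants. -/
lemma hasSum_dualFilter_one (hW : IsInterpolatingMRA φ W) :
    HasSum (fun l => dualFilter φ 1 l) 0 := by
  rw [← neg_add_cancel (1 : K)]
  refine HasSum.int_even_add_odd ?_ ?_
  · simp only [dualFilter_one_even]
    exact (hW.hasSum_translates (1 / 2)).neg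
  · simp only [hW.dualFilter_one_odd]
    exact hasSum_ite_eq 0 1

lemma exists_dualFilter_eq_zero (hW : IsInterpolatingMRA φ W) :
    ∃ L : ℕ, ∀ (b : Fin 2) (l : ℤ), (L : ℤ) < |l| → dualFilter φ b l = 0 := by
  obtain ⟨R, -, hR⟩ := hW.exists_forall_le_abs
  refine ⟨2 * R + 1, fun b l hl => ?_⟩
  push_cast at hl
  rw [dualFilter]
  split_ifs with h1 h2
  · subst h2; simp at hl; omega
  · rfl
  · rw [hR, mul_zero]
    have h3 : 2 * (R : ℤ) ≤ |1 - l| := by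
      have := abs_sub_abs_le_abs_sub l 1
      rw [abs_one, abs_sub_comm] at this
      omega
    have h4 : 2 * (R : ℝ) ≤ |1 - (l : ℝ)| := by exact_mod_cast h3
    rw [abs_div, abs_two, le_div_iff₀ two_pos]
    linarith

/-- The decomposition of a fine scaling function into coarse scaling functions and wavelets, with
the coefficients of the dual functionals. For odd `m` it is the definition of the wavelet, for even
`m` the refinement equation, solved for the term with `φ(2t - m)`. -/
lemma hasSum_dualFilter_mul_motherFun (hW : IsInterpolatingMRA φ W) (m : ℤ) (t : ℝ) :
    HasSum (fun k : ℤ => ∑ b, dualFilter φ b (m - 2 * k) * motherFun φ b (t - k))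
      (φ (2 * t - m)) := by
  simp only [Fin.sum_univ_two]
  have hb0 : ∀ l, dualFilter φ 0 l = if l = 0 then 1 else 0 := fun l => by simp [dualFilter]
  have hm0 : ∀ s, motherFun φ 0 s = φ s := fun s => by simp [motherFun]
  have hm1 : ∀ s, motherFun φ 1 s = φ (2 * s - 1) := fun s => by simp [motherFun]
  simp only [hb0, hm0, hm1]
  rcases Int.even_or_odd' m with ⟨p, rfl | rfl⟩
  · set s := ∑' k : ℤ, φ (k + 1 / 2) * φ (2 * (t - p) - (2 * k + 1)) with hs
    have href := hW.hasSum_refinement (t - p)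
    have hodd : HasSum (fun k : ℤ => φ (k + 1 / 2) * φ (2 * (t - p) - (2 * k + 1))) s := by
      refine Summable.hasSum ?_
      refine (summable_congr fun k => ?_).1 (href.summable.comp_injective
        (i := fun k : ℤ => 2 * k + 1) (fun a b h => by simpa using h))
      rw [Function.comp_apply]
      push_cast
      congr 2
      ring
    have heven : HasSum (fun k : ℤ => φ k * φ (2 * (t - p) - 2 * k)) (φ (2 * (t - p))) := by
      convert hasSum_ite_eq (0 : ℤ) (φ (2 * (t - p))) using 2 with k
      rw [hW.interpolating]
      by_cases hk : k = 0 <;> simp [hk]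
    have hsum : φ (2 * (t - p)) + s = φ (t - p) := by
      refine HasSum.unique (HasSum.int_even_add_odd ?_ ?_) href
      · simpa using heven
      · convert hodd using 2 with k
        push_cast
        congr 2
        ring
    have hfst : HasSum (fun k : ℤ => (if 2 * p - 2 * k = 0 then (1 : K) else 0) * φ (t - k))
        (φ (t - p)) := by
      convert hasSum_ite_eq p (φ (t - p)) using 2 with k
      by_cases hk : k = p
      · simp [hk]
      · rw [if_neg (by omega), if_neg hk, zero_mul]
    have hsnd : HasSum (fun k : ℤ => dualFilter φ 1 (2 * p - 2 * k) * φ (2 * (t - k) - 1)) (-s) := by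
      refine (congrArg (fun f => HasSum f (-s)) (funext fun k => ?_)).mp
        ((Equiv.subRight p).hasSum_iff.2 hodd).neg
      rw [Function.comp_apply, Equiv.subRight_apply, ← mul_sub, dualFilter_one_even, neg_mul]
      push_cast
      congr 3 <;> ring
    convert hfst.add hsnd using 1
    rw [← hsum]
    push_cast
    rw [mul_sub]
    ring
  · convert hasSum_ite_eq p (φ (2 * t - ((2 * p + 1 : ℤ) : ℝ))) using 2 with k
    have h1 : 2 * p + 1 - 2 * k = 2 * (p - k) + 1 := by ring
    rw [if_neg (by omega), zero_mul, zero_add, h1, hW.dualFilter_one_odd]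
    by_cases hk : k = p
    · subst hk
      rw [sub_self, if_pos rfl, if_pos rfl, one_mul]
      push_cast
      congr 1
      ring
    · rw [if_neg (by omega), if_neg hk, zero_mul]

end IsInterpolatingMRA

end DualFilter

end OneDim

/-! ### Tensor product wavelets -/

section Tensor

variable {K : Type*} [RCLike K] {φ : ℝ → K} {n : ℕ}

lemma motherFun_eq_zero {R : ℕ} (hR1 : 1 ≤ R) (hR : ∀ t : ℝ, (R : ℝ) ≤ |t| → φ t = 0) (b : Fin 2)
    {t : ℝ} (ht : (R : ℝ) ≤ |t|) : motherFun φ b t = 0 := by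
  rw [motherFun]
  split_ifs
  · exact hR t ht
  · refine hR _ ?_
    have h1 := abs_sub_abs_le_abs_sub (2 * t) 1
    have h2 : (1 : ℝ) ≤ R := by exact_mod_cast hR1
    rw [abs_mul, abs_two, abs_one] at h1
    linarith

/-- The multi-indices `k` near `2ʲ x`, outside of which `ψ_{s,j,k}(x)` vanishes. -/
noncomputable def levelWindow (R : ℕ) (j : ℤ) (x : EuclideanSpace ℝ (Fin n)) :
    Finset (Fin n → ℤ) :=
  Fintype.piFinset fun i => intWindow R (2 ^ j * x i)

lemma card_levelWindow (R : ℕ) (j : ℤ) (x : EuclideanSpace ℝ (Fin n)) :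
    (levelWindow R j x).card = (2 * R + 2) ^ n := by
  simp [levelWindow, Fintype.card_piFinset, card_intWindow]

lemma tensorWavelet_eq_zero {R : ℕ} (hR1 : 1 ≤ R) (hR : ∀ t : ℝ, (R : ℝ) ≤ |t| → φ t = 0)
    (s : Fin n → Fin 2) (j : ℤ) {k : Fin n → ℤ} {x : EuclideanSpace ℝ (Fin n)}
    (hk : k ∉ levelWindow R j x) : tensorWavelet φ s j k x = 0 := by
  simp only [levelWindow, Fintype.mem_piFinset, not_forall] at hk
  obtain ⟨i, hi⟩ := hk
  exact Finset.prod_eq_zero (Finset.mem_univ i)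
    (motherFun_eq_zero hR1 hR _ (le_abs_sub_of_notMem_intWindow hi))

lemma norm_tensorWavelet_le {B : ℝ} (hB : ∀ t, ‖φ t‖ ≤ B) (s : Fin n → Fin 2) (j : ℤ)
    (k : Fin n → ℤ) (x : EuclideanSpace ℝ (Fin n)) : ‖tensorWavelet φ s j k x‖ ≤ B ^ n := by
  rw [tensorWavelet, norm_prod]
  calc _ ≤ ∏ _i : Fin n, B := Finset.prod_le_prod (fun _ _ => norm_nonneg _) fun i _ => by
        rw [motherFun]; split_ifs <;> exact hB _
    _ = B ^ n := by simp

lemma dualWavelet_eq_sum {L : ℕ} (hL : ∀ (b : Fin 2) (l : ℤ), (L : ℤ) < |l| → dualFilter φ b l = 0)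
    (s : Fin n → Fin 2) (j : ℤ) (k : Fin n → ℤ) (f : EuclideanSpace ℝ (Fin n) → K) :
    dualWavelet φ s j k f = ∑ l ∈ Fintype.piFinset fun _ => Finset.Icc (-(L : ℤ)) L,
      (∏ i, dualFilter φ (s i) (l i)) *
        f (WithLp.toLp 2 fun i => (2 : ℝ) ^ (-j) * (k i + l i / 2)) := by
  refine finsum_eq_sum_of_support_subset _ fun l hl => ?_
  by_contra hcon
  simp only [Finset.mem_coe, Fintype.mem_piFinset, not_forall, Finset.mem_Icc, ← abs_le,
    not_le] at hcon
  obtain ⟨i, hi⟩ := hcon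
  exact hl (mul_eq_zero_of_left (Finset.prod_eq_zero (Finset.mem_univ i) (hL _ _ hi)) _)

lemma dualWavelet_zero (j : ℤ) (k : Fin n → ℤ) (f : EuclideanSpace ℝ (Fin n) → K) :
    dualWavelet φ 0 j k f = f (WithLp.toLp 2 fun i => (2 : ℝ) ^ (-j) * k i) := by
  rw [dualWavelet, finsum_eq_single _ 0]
  · simp [dualFilter]
  · intro l hl
    obtain ⟨i, hi⟩ := Function.ne_iff.1 hl
    rw [Finset.prod_eq_zero (Finset.mem_univ i), zero_mul]
    simpa [dualFilter] using hi

/-- The coarse part of the expansion at level `j`: the interpolant `∑ₖ g(2⁻ʲ k) φ^{[n]}(2ʲ x - k)`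
of `g`, restricted to the finitely many nonzero terms. -/
noncomputable def levelInterpolant (φ : ℝ → K) (R : ℕ) (g : EuclideanSpace ℝ (Fin n) → K) (j : ℤ)
    (x : EuclideanSpace ℝ (Fin n)) : K :=
  ∑ k ∈ levelWindow R j x, dualWavelet φ 0 j k g * tensorWavelet φ 0 j k x

lemma norm_le_of_forall_abs_le {v : EuclideanSpace ℝ (Fin n)} {a : ℝ} (ha : 0 ≤ a)
    (hv : ∀ i, |v i| ≤ a) : ‖v‖ ≤ n * a := by
  rw [EuclideanSpace.norm_eq]
  refine Real.sqrt_le_iff.2 ⟨by positivity, ?_⟩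
  calc ∑ i, ‖v i‖ ^ 2 ≤ ∑ _i : Fin n, a ^ 2 := Finset.sum_le_sum fun i _ => by
        rw [Real.norm_eq_abs]
        exact pow_le_pow_left₀ (abs_nonneg _) (hv i) 2
    _ = n * a ^ 2 := by simp
    _ ≤ (n * a) ^ 2 := by
        rw [mul_pow]
        gcongr
        exact_mod_cast Nat.le_self_pow two_ne_zero n

lemma abs_sub_le_of_mem_intWindow {R : ℕ} {y : ℝ} {k : ℤ} (hk : k ∈ intWindow R y) :
    |y - k| ≤ R + 1 := by
  rw [intWindow, Finset.mem_Icc] at hk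
  have h1 : ((⌊y⌋ - R : ℤ) : ℝ) ≤ k := by exact_mod_cast hk.1
  have h2 : (k : ℝ) ≤ ((⌊y⌋ + R + 1 : ℤ) : ℝ) := by exact_mod_cast hk.2
  have h3 := Int.floor_le y
  have h4 := Int.lt_floor_add_one y
  push_cast at h1 h2
  rw [abs_le]
  constructor <;> linarith

variable {W : ℤ → Submodule K (ℝ →ᵇ K)}

namespace IsInterpolatingMRA

/-- Passing from level `j` to level `j + 1` adds the wavelets of level `j`: the tensor product of
the one-dimensional decompositions of the fine scaling functions. -/
lemma levelInterpolant_succ (hW : IsInterpolatingMRA φ W) {R : ℕ} (hR1 : 1 ≤ R)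
    (hR : ∀ t : ℝ, (R : ℝ) ≤ |t| → φ t = 0) (g : EuclideanSpace ℝ (Fin n) → K) (j : ℤ)
    (x : EuclideanSpace ℝ (Fin n)) :
    levelInterpolant φ R g (j + 1) x
      = ∑ s, ∑ k ∈ levelWindow R j x, dualWavelet φ s j k g * tensorWavelet φ s j k x := by
  obtain ⟨L, hL⟩ := hW.exists_dualFilter_eq_zero
  set y : Fin n → ℝ := fun i => 2 ^ j * x i with hy
  have hy2 : ∀ i, (2 : ℝ) ^ (j + 1) * x i = 2 * y i := fun i => by
    rw [zpow_add_one₀ two_ne_zero, hy]; ring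
  -- all fine indices `m` that carry a nonzero term on either side
  set A : Fin n → Finset ℤ := fun i => intWindow R (2 * y i) ∪
    (intWindow R (y i) ×ˢ Finset.Icc (-(L : ℤ)) L).image fun p => 2 * p.1 + p.2 with hA
  set G : (Fin n → ℤ) → K := fun m => g (WithLp.toLp 2 fun i => (2 : ℝ) ^ (-j) * (m i / 2)) with hG
  have hleft : levelInterpolant φ R g (j + 1) x
      = ∑ m ∈ Fintype.piFinset A, G m * ∏ i, φ (2 * y i - m i) := by
    rw [levelInterpolant, levelWindow]
    have hsub : (Fintype.piFinset fun i => intWindow R (2 ^ (j + 1) * x i)) ⊆ Fintype.piFinset A :=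
      Fintype.piFinset_subset _ _ fun i => by rw [hy2]; exact Finset.subset_union_left
    rw [← Finset.sum_subset hsub]
    · refine Finset.sum_congr rfl fun m _ => ?_
      rw [dualWavelet_zero, hG, tensorWavelet]
      congr 1
      · congr 2
        funext i
        rw [neg_add, ← sub_eq_add_neg, zpow_sub_one₀ two_ne_zero]
        ring
      · refine Finset.prod_congr rfl fun i _ => ?_
        rw [hy2]
        simp [motherFun]
    · intro m _ hm
      simp only [Fintype.mem_piFinset, not_forall] at hm
      obtain ⟨i, hi⟩ := hm
      rw [hy2] at hi
      rw [Finset.prod_eq_zero (Finset.mem_univ i) (hR _ (le_abs_sub_of_notMem_intWindow hi)),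
        mul_zero]
  have hdual : ∀ s, ∀ k ∈ levelWindow R j x, dualWavelet φ s j k g
      = ∑ m ∈ Fintype.piFinset A, (∏ i, dualFilter φ (s i) (m i - 2 * k i)) * G m := by
    intro s k hk
    rw [levelWindow, Fintype.mem_piFinset] at hk
    rw [dualWavelet, ← finsum_comp_equiv (Equiv.subRight (fun i => 2 * k i))]
    rw [finsum_eq_sum_of_support_subset (s := Fintype.piFinset A)]
    · refine Finset.sum_congr rfl fun m _ => ?_
      simp only [Equiv.subRight_apply, Pi.sub_apply, hG]
      congr 3
      funext i
      push_cast
      ring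
    · intro m hm
      by_contra hcon
      simp only [Finset.mem_coe, Fintype.mem_piFinset, not_forall] at hcon
      obtain ⟨i, hi⟩ := hcon
      refine hm (mul_eq_zero_of_left (Finset.prod_eq_zero (Finset.mem_univ i) ?_) _)
      refine hL _ _ (not_le.1 fun hle => hi ?_)
      refine Finset.mem_union_right _ (Finset.mem_image.2 ⟨(k i, m i - 2 * k i), ?_, by simp⟩)
      exact Finset.mem_product.2 ⟨hk i, Finset.mem_Icc.2 (abs_le.1 hle)⟩
  have hprod : ∀ m : Fin n → ℤ, ∏ i, φ (2 * y i - m i) = ∑ s : Fin n → Fin 2,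
      ∑ k ∈ levelWindow R j x, (∏ i, dualFilter φ (s i) (m i - 2 * k i)) *
        tensorWavelet φ s j k x := by
    intro m
    have h1 : ∀ i, φ (2 * y i - m i) = ∑ b, ∑ k ∈ intWindow R (y i),
        dualFilter φ b (m i - 2 * k) * motherFun φ b (y i - k) := by
      intro i
      rw [Finset.sum_comm]
      have h := hW.hasSum_dualFilter_mul_motherFun (m i) (y i)
      refine h.unique (hasSum_sum_of_ne_finset_zero fun k hk => Finset.sum_eq_zero fun b _ => ?_)
      rw [motherFun_eq_zero hR1 hR b (le_abs_sub_of_notMem_intWindow hk), mul_zero]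
    simp only [h1, Fintype.prod_sum, Finset.prod_univ_sum]
    refine Finset.sum_congr rfl fun s _ => Finset.sum_congr rfl fun k _ => ?_
    rw [Finset.prod_mul_distrib]
    rfl
  rw [hleft]
  simp only [hprod, Finset.mul_sum]
  rw [Finset.sum_comm]
  refine Finset.sum_congr rfl fun s _ => ?_
  rw [Finset.sum_comm]
  refine Finset.sum_congr rfl fun k hk => ?_
  rw [hdual s k hk, Finset.sum_mul]
  exact Finset.sum_congr rfl fun m _ => by ring

/-- By the partition of unity, the interpolation error at `x` averages the oscillation of `g` over
points at distance `O(2⁻ʲ)` from `x`. -/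
lemma exists_norm_levelInterpolant_sub_le (hW : IsInterpolatingMRA φ W) {R : ℕ}
    (hR : ∀ t : ℝ, (R : ℝ) ≤ |t| → φ t = 0) {g : EuclideanSpace ℝ (Fin n) → K} {C β : ℝ}
    (hC0 : 0 ≤ C) (hβ : 0 ≤ β) (hg : ∀ x y, ‖g x - g y‖ ≤ C * ‖x - y‖ ^ β) :
    ∃ D : ℝ, ∀ j x, ‖levelInterpolant φ R g j x - g x‖ ≤ D * ((2 : ℝ) ^ (-j)) ^ β := by
  obtain ⟨B, hB⟩ := hW.exists_norm_le
  refine ⟨(((2 * R + 2) ^ n : ℕ) : ℝ) * (C * (n * (R + 1)) ^ β * B ^ n), fun j x => ?_⟩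
  have hone : ∑ k ∈ levelWindow R j x, tensorWavelet φ 0 j k x = 1 := by
    simp only [tensorWavelet, levelWindow]
    rw [← Finset.prod_univ_sum (fun i => intWindow R (2 ^ j * x i))
      (fun i k => motherFun φ ((0 : Fin n → Fin 2) i) (2 ^ j * x i - k))]
    refine Finset.prod_eq_one fun i _ => ?_
    have h := hasSum_sum_of_ne_finset_zero (L := .unconditional ℤ)
      (f := fun k : ℤ => φ (2 ^ j * x i - k))
      (s := intWindow R (2 ^ j * x i)) fun k hk => hR _ (le_abs_sub_of_notMem_intWindow hk)
    simpa [motherFun] using h.unique (hW.hasSum_translates (2 ^ j * x i))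
  have hsub : levelInterpolant φ R g j x - g x
      = ∑ k ∈ levelWindow R j x, (dualWavelet φ 0 j k g - g x) * tensorWavelet φ 0 j k x := by
    simp only [sub_mul, Finset.sum_sub_distrib, ← Finset.mul_sum, hone, mul_one]
    rfl
  rw [hsub, ← card_levelWindow R j x, mul_assoc, ← nsmul_eq_mul]
  refine (norm_sum_le _ _).trans (Finset.sum_le_card_nsmul _ _ _ fun k hk => ?_)
  have hB0 : 0 ≤ B := (norm_nonneg _).trans (hB 0)
  rw [norm_mul, mul_right_comm]
  refine mul_le_mul ?_ (norm_tensorWavelet_le hB _ _ _ _) (norm_nonneg _) (by positivity)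
  rw [dualWavelet_zero, mul_assoc, ← Real.mul_rpow (by positivity) (by positivity)]
  refine (hg _ _).trans (mul_le_mul_of_nonneg_left ?_ hC0)
  refine Real.rpow_le_rpow (norm_nonneg _) ?_ hβ
  rw [mul_assoc]
  refine norm_le_of_forall_abs_le (by positivity) fun i => ?_
  rw [levelWindow, Fintype.mem_piFinset] at hk
  have h1 : (2 : ℝ) ^ (-j) * k i - x i = -(2 ^ (-j) * (2 ^ j * x i - k i)) := by
    rw [mul_sub, ← mul_assoc, ← zpow_add₀ two_ne_zero]
    simp
  rw [PiLp.sub_apply, PiLp.toLp_apply, h1, abs_neg, abs_mul, abs_of_pos (by positivity), mul_comm]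
  exact mul_le_mul_of_nonneg_right (abs_sub_le_of_mem_intWindow (hk i)) (by positivity)

/-- The wavelet coefficients of a Hölder function decay geometrically in the level, as the dual
wavelets annihilate constants. -/
lemma exists_norm_dualWavelet_le (hW : IsInterpolatingMRA φ W)
    {g : EuclideanSpace ℝ (Fin n) → K} {C β : ℝ}
    (hC0 : 0 ≤ C) (hβ : 0 ≤ β) (hg : ∀ x y, ‖g x - g y‖ ≤ C * ‖x - y‖ ^ β) :
    ∃ D : ℝ, 0 ≤ D ∧ ∀ s ≠ 0, ∀ j k, ‖dualWavelet φ s j k g‖ ≤ D * ((2 : ℝ) ^ (-j)) ^ β := by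
  obtain ⟨B, hB⟩ := hW.exists_norm_le
  obtain ⟨L, hL⟩ := hW.exists_dualFilter_eq_zero
  have hB1 : 1 ≤ B := by
    have h1 := hB ((0 : ℤ) : ℝ)
    rwa [hW.interpolating, if_pos rfl, norm_one] at h1
  set P : Finset (Fin n → ℤ) := Fintype.piFinset fun _ => Finset.Icc (-(L : ℤ)) L with hP
  refine ⟨(P.card : ℝ) * (B ^ n * (C * (n * L) ^ β)), by positivity, fun s hs j k => ?_⟩
  have hfil : ∀ b l, ‖dualFilter φ b l‖ ≤ B := by
    intro b l
    rw [dualFilter]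
    split_ifs
    · simpa using hB1
    · simpa using zero_le_one.trans hB1
    · rw [norm_mul, norm_zpow, norm_neg, norm_one, one_zpow, one_mul]
      exact hB _
  have hzero : ∑ l ∈ P, ∏ i, dualFilter φ (s i) (l i) = 0 := by
    obtain ⟨i, hi⟩ := Function.ne_iff.1 hs
    have hi1 : s i = 1 := Fin.eq_one_of_ne_zero _ hi
    rw [hP, ← Finset.prod_univ_sum (fun _ => Finset.Icc (-(L : ℤ)) L)
      (fun i l => dualFilter φ (s i) l)]
    refine Finset.prod_eq_zero (Finset.mem_univ i) ?_
    rw [hi1]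
    refine (hasSum_sum_of_ne_finset_zero fun l hl => hL 1 l ?_).unique hW.hasSum_dualFilter_one
    rwa [Finset.mem_Icc, ← abs_le, not_le] at hl
  set z : EuclideanSpace ℝ (Fin n) := WithLp.toLp 2 fun i => (2 : ℝ) ^ (-j) * k i with hz
  have hsub : dualWavelet φ s j k g = ∑ l ∈ P, (∏ i, dualFilter φ (s i) (l i)) *
      (g (WithLp.toLp 2 fun i => (2 : ℝ) ^ (-j) * (k i + l i / 2)) - g z) := by
    simp only [mul_sub, Finset.sum_sub_distrib, ← Finset.sum_mul, hzero, zero_mul, sub_zero]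
    exact dualWavelet_eq_sum hL s j k g
  rw [hsub, mul_assoc, ← nsmul_eq_mul]
  refine (norm_sum_le _ _).trans (Finset.sum_le_card_nsmul _ _ _ fun l hl => ?_)
  rw [norm_mul, mul_assoc]
  refine mul_le_mul ?_ ?_ (norm_nonneg _) (by positivity)
  · rw [norm_prod]
    calc _ ≤ ∏ _i : Fin n, B :=
          Finset.prod_le_prod (fun _ _ => norm_nonneg _) fun i _ => hfil _ _
      _ = B ^ n := by simp
  · rw [mul_assoc, ← Real.mul_rpow (by positivity) (by positivity)]
    refine (hg _ _).trans (mul_le_mul_of_nonneg_left ?_ hC0)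
    refine Real.rpow_le_rpow (norm_nonneg _) ?_ hβ
    rw [mul_assoc]
    refine norm_le_of_forall_abs_le (by positivity) fun i => ?_
    rw [hP, Fintype.mem_piFinset] at hl
    have h1 : |(l i : ℝ)| ≤ L := by exact_mod_cast abs_le.2 (Finset.mem_Icc.1 (hl i))
    have h2 : (2 : ℝ) ^ (-j) * (k i + l i / 2) - 2 ^ (-j) * k i = l i / 2 * 2 ^ (-j) := by ring
    rw [PiLp.sub_apply, hz, PiLp.toLp_apply, PiLp.toLp_apply, h2, abs_mul,
      abs_of_pos (by positivity : (0 : ℝ) < 2 ^ (-j))]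
    refine mul_le_mul_of_nonneg_right ?_ (by positivity)
    rw [abs_div, abs_two]
    linarith [abs_nonneg (l i : ℝ)]

end IsInterpolatingMRA

end Tensor

/-! ### Summation over the levels -/

section Summation

variable {K : Type*} [RCLike K]

/-- A series over `ℕ × Γ` whose level sums are finite, absolutely summable over the levels, and
have converging partial sums. -/
lemma summable_norm_and_hasSum_of_levels {Γ : Type*} {F : ℕ × Γ → K} (S : ℕ → Finset Γ)
    (hS : ∀ N, ∀ γ ∉ S N, F (N, γ) = 0) (hb : Summable fun N => ∑ γ ∈ S N, ‖F (N, γ)‖) {a : K}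
    (ha : Filter.Tendsto (fun M => ∑ N ∈ Finset.range M, ∑ γ ∈ S N, F (N, γ)) Filter.atTop
      (nhds a)) :
    Summable (fun p => ‖F p‖) ∧ HasSum F a := by
  have hlev : ∀ N, HasSum (fun γ => F (N, γ)) (∑ γ ∈ S N, F (N, γ)) := fun N =>
    hasSum_sum_of_ne_finset_zero (hS N)
  have hlevn : ∀ N, HasSum (fun γ => ‖F (N, γ)‖) (∑ γ ∈ S N, ‖F (N, γ)‖) := fun N =>
    hasSum_sum_of_ne_finset_zero fun γ hγ => by rw [hS N γ hγ, norm_zero]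
  have hsum : Summable (fun p => ‖F p‖) := by
    refine (summable_prod_of_nonneg fun p => norm_nonneg (F p)).2 ⟨fun N => (hlevn N).summable, ?_⟩
    simpa only [(hlevn _).tsum_eq] using hb
  refine ⟨hsum, ?_⟩
  have h1 := hsum.of_norm.hasSum
  have h2 := (h1.prod_fiberwise hlev).tendsto_sum_nat
  rwa [tendsto_nhds_unique ha h2]

/-- Absolute summation over a subset can be carried out in an injective parametrization `e` whose
range contains the subset. -/
lemma summable_norm_and_hasSum_subtype {ι ι' : Type*} {s : Set ι} {T : ι → K} {e : ι' → ι}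
    (he : Function.Injective e) (hs : s ⊆ range e) {a : K}
    (h : Summable (fun p => ‖s.indicator T (e p)‖) ∧ HasSum (fun p => s.indicator T (e p)) a) :
    Summable (fun α : s => ‖T α‖) ∧ HasSum (fun α : s => T α) a := by
  have h0 : ∀ α ∉ range e, s.indicator T α = 0 := fun α hα =>
    indicator_of_notMem (fun hmem => hα (hs hmem)) _
  constructor
  · have h1 : Summable fun α => ‖s.indicator T α‖ :=
      (he.summable_iff fun α hα => by rw [h0 α hα, norm_zero]).1 h.1
    simp only [norm_indicator_eq_indicator_norm] at h1
    exact summable_subtype_iff_indicator.2 h1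
  · exact hasSum_subtype_iff_indicator.2 ((he.hasSum_iff h0).1 h.2)

variable {φ : ℝ → K} {n : ℕ} {W : ℤ → Submodule K (ℝ →ᵇ K)}

/-- The wavelet expansion of a Hölder function `g` converges to `g`, absolutely at each point: the
level sums decay geometrically, and they telescope to the interpolants of `g`. -/
lemma IsInterpolatingMRA.summable_norm_and_hasSum_wavelet (hW : IsInterpolatingMRA φ W) (j₀ : ℤ)
    {g : EuclideanSpace ℝ (Fin n) → K} {C β : ℝ} (hC0 : 0 ≤ C) (hβ : 0 < β)
    (hg : ∀ x y, ‖g x - g y‖ ≤ C * ‖x - y‖ ^ β) (x : EuclideanSpace ℝ (Fin n)) :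
    Summable (fun α : waveletIndex n j₀ =>
      ‖dualWavelet φ α.1.1 α.1.2.1 α.1.2.2 g * tensorWavelet φ α.1.1 α.1.2.1 α.1.2.2 x‖) ∧
    HasSum (fun α : waveletIndex n j₀ =>
      dualWavelet φ α.1.1 α.1.2.1 α.1.2.2 g * tensorWavelet φ α.1.1 α.1.2.1 α.1.2.2 x) (g x) := by
  obtain ⟨R, hR1, hR⟩ := hW.exists_forall_le_abs
  obtain ⟨B, hB⟩ := hW.exists_norm_le
  obtain ⟨D, hD⟩ := hW.exists_norm_levelInterpolant_sub_le (n := n) hR hC0 hβ.le hg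
  obtain ⟨D', hD'0, hD'⟩ := hW.exists_norm_dualWavelet_le hC0 hβ.le hg
  have hB0 : 0 ≤ B := (norm_nonneg _).trans (hB 0)
  set T : (Fin n → Fin 2) × ℤ × (Fin n → ℤ) → K := fun α =>
    dualWavelet φ α.1 α.2.1 α.2.2 g * tensorWavelet φ α.1 α.2.1 α.2.2 x with hT
  -- the index set is parametrized by `N = j - j₀` and `(s, k)`, with `N = 0` if `s = 0`
  set e : ℕ × ((Fin n → Fin 2) × (Fin n → ℤ)) → (Fin n → Fin 2) × ℤ × (Fin n → ℤ) :=
    fun p => (p.2.1, j₀ + p.1, p.2.2) with he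
  have heinj : Function.Injective e := by
    rintro ⟨N, s, k⟩ ⟨N', s', k'⟩ h
    simp only [he, Prod.mk.injEq, add_right_inj, Nat.cast_inj] at h
    obtain ⟨h1, h2, h3⟩ := h
    rw [h1, h2, h3]
  have herange : waveletIndex n j₀ ⊆ range e := by
    rintro ⟨s, j, k⟩ hmem
    have hj : j₀ ≤ j := hmem.elim (fun h => h.2.symm.le) fun h => h.2
    exact ⟨((j - j₀).toNat, s, k), by simp [he, Int.toNat_of_nonneg (sub_nonneg.2 hj)]⟩
  set F : ℕ × ((Fin n → Fin 2) × (Fin n → ℤ)) → K :=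
    fun p => (waveletIndex n j₀).indicator T (e p) with hF
  refine summable_norm_and_hasSum_subtype (T := T) heinj herange ?_
  change Summable (fun p => ‖F p‖) ∧ HasSum F (g x)
  have hF0 : ∀ s k, F (0, s, k) = T (s, j₀, k) := fun s k => by
    have h1 : e (0, s, k) = (s, j₀, k) := by simp [he]
    rw [hF]
    simp only [h1]
    refine indicator_of_mem ?_ _
    by_cases hs : s = 0
    · exact Or.inl ⟨hs, rfl⟩
    · exact Or.inr ⟨hs, le_rfl⟩
  have hFz : ∀ N k, F (N + 1, 0, k) = 0 := fun N k => by
    refine indicator_of_notMem (fun hmem => ?_) _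
    rcases hmem with h | h
    · have := h.2
      simp only [he] at this
      push_cast at this
      omega
    · exact h.1 rfl
  have hFs : ∀ N s k, s ≠ 0 → F (N, s, k) = T (s, j₀ + N, k) := fun N s k hs => by
    refine indicator_of_mem (s := waveletIndex n j₀) (a := e (N, s, k)) (Or.inr ⟨hs, ?_⟩) T
    simp [he]
  set S : ℕ → Finset ((Fin n → Fin 2) × (Fin n → ℤ)) := fun N =>
    Finset.univ ×ˢ levelWindow R (j₀ + N) x with hSdef
  have hrate : ∀ N : ℕ, ((2 : ℝ) ^ (-(j₀ + N))) ^ β = (2 ^ (-j₀)) ^ β * ((2⁻¹) ^ β) ^ N := by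
    intro N
    rw [← Real.rpow_natCast, ← Real.rpow_mul (by positivity), mul_comm β,
      Real.rpow_mul (by positivity), Real.rpow_natCast,
      ← Real.mul_rpow (by positivity) (by positivity), neg_add, zpow_add₀ two_ne_zero,
      zpow_neg _ (N : ℤ), zpow_natCast, inv_pow]
  have hlt : ((2 : ℝ)⁻¹) ^ β < 1 := Real.rpow_lt_one (by norm_num) (by norm_num) hβ
  have hgeo : Summable fun N : ℕ => ((2 : ℝ) ^ (-(j₀ + N))) ^ β := by
    simp only [hrate]
    exact (summable_geometric_of_lt_one (by positivity) hlt).mul_left _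
  have hTz : ∀ s j, ∀ k ∉ levelWindow R j x, T (s, j, k) = 0 := fun s j k hk => by
    rw [hT]
    simp only
    rw [tensorWavelet_eq_zero hR1 hR s j hk, mul_zero]
  refine summable_norm_and_hasSum_of_levels S ?_ ?_ ?_
  · rintro N ⟨s, k⟩ hsk
    have hk : k ∉ levelWindow R (j₀ + N) x := fun h => hsk (by simp [hSdef, h])
    simp only [hF, he]
    by_cases hmem : (s, j₀ + (N : ℤ), k) ∈ waveletIndex n j₀
    · rw [indicator_of_mem hmem, hTz _ _ _ hk]
    · rw [indicator_of_notMem hmem]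
  · rw [← summable_nat_add_iff 1]
    set c : ℝ := ((Fintype.card (Fin n → Fin 2) * (2 * R + 2) ^ n : ℕ) : ℝ) with hc
    have hgeo1 := ((summable_nat_add_iff 1).2 hgeo).mul_left (c * (D' * B ^ n))
    refine Summable.of_nonneg_of_le (fun N => Finset.sum_nonneg fun _ _ => norm_nonneg _)
      (fun N => ?_) hgeo1
    have hcard : (S (N + 1)).card = Fintype.card (Fin n → Fin 2) * (2 * R + 2) ^ n := by
      rw [hSdef, Finset.card_product, card_levelWindow, Finset.card_univ]
    rw [mul_assoc, hc, ← hcard, ← nsmul_eq_mul]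
    refine Finset.sum_le_card_nsmul _ _ _ ?_
    rintro ⟨s, k⟩ -
    by_cases hs : s = 0
    · rw [hs, hFz, norm_zero]
      positivity
    · rw [hFs _ _ _ hs, hT, norm_mul, mul_right_comm]
      exact mul_le_mul (hD' s hs _ _) (norm_tensorWavelet_le hB _ _ _ _) (norm_nonneg _)
        (by positivity)
  · have hpart : ∀ M : ℕ, ∑ N ∈ Finset.range (M + 1), ∑ p ∈ S N, F (N, p)
        = levelInterpolant φ R g (j₀ + M + 1) x := by
      intro M
      induction M with
      | zero =>
        rw [zero_add, Finset.sum_range_one, Nat.cast_zero, add_zero,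
          hW.levelInterpolant_succ hR1 hR, hSdef, Finset.sum_product]
        simp only [hF0, Nat.cast_zero, add_zero, hT]
      | succ M ih =>
        rw [Finset.sum_range_succ, ih, hW.levelInterpolant_succ hR1 hR g (j₀ + ((M + 1 : ℕ) : ℤ)),
          hSdef, Finset.sum_product, ← Finset.add_sum_erase _ _ (Finset.mem_univ 0),
          ← Finset.add_sum_erase (Finset.univ : Finset (Fin n → Fin 2)) _ (Finset.mem_univ 0)]
        simp only [hFz, Finset.sum_const_zero, zero_add]
        congr 1
        · rw [levelInterpolant, Nat.cast_succ, add_assoc]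
        · refine Finset.sum_congr rfl fun s hs => Finset.sum_congr rfl fun k _ => ?_
          rw [hFs _ _ _ (Finset.ne_of_mem_erase hs)]
    rw [← Filter.tendsto_add_atTop_iff_nat 1]
    simp only [hpart]
    rw [tendsto_iff_norm_sub_tendsto_zero]
    have h0 := ((Filter.tendsto_add_atTop_iff_nat 1).2 hgeo.tendsto_atTop_zero).const_mul D
    rw [mul_zero] at h0
    refine squeeze_zero (fun _ => norm_nonneg _) (fun M => ?_) h0
    have h1 := hD (j₀ + M + 1) x
    rwa [add_assoc, ← Nat.cast_succ] at h1 ⊢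

end Summation

/-! ### The wavelet expansion of a Besov function -/

theorem mainTheorem4 {K : Type*} [RCLike K] {n : ℕ} (hn : 0 < n) (j₀ : ℤ)
    {σ r : ℝ} (hσ : 0 < σ) (hr : σ < r) {q : ℝ≥0∞} (hq : 1 ≤ q)
    (φ : ℝ → K) (V : ℤ → Submodule K (EuclideanSpace ℝ (Fin n) →ᵇ K))
    (hV : IsTensorProductMRA φ V) (hφ : MemHolderSpace r (tensorScaling n φ))
    (f : EuclideanSpace ℝ (Fin n) → K) (hf : MemBesov σ ∞ q f) :
    (∃ g : EuclideanSpace ℝ (Fin n) → K,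
      UniformContinuous g ∧ (∃ C : ℝ, ∀ x, ‖g x‖ ≤ C) ∧ g =ᵐ[volume] f) ∧
    ∀ g : EuclideanSpace ℝ (Fin n) → K, Continuous g → g =ᵐ[volume] f →
      ∀ x : EuclideanSpace ℝ (Fin n),
        Summable (fun α : waveletIndex n j₀ =>
          ‖dualWavelet φ α.1.1 α.1.2.1 α.1.2.2 g * tensorWavelet φ α.1.1 α.1.2.1 α.1.2.2 x‖) ∧
        HasSum (fun α : waveletIndex n j₀ =>
          dualWavelet φ α.1.1 α.1.2.1 α.1.2.2 g * tensorWavelet φ α.1.1 α.1.2.1 α.1.2.2 x)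
          (g x) := by
  obtain ⟨W, hW⟩ := hV.factor
  obtain ⟨g, B, C, β, hβ, hgB, hgC, hgf⟩ := hf.exists_holder_representative hσ hq
  have hg : ∀ x y, ‖g x - g y‖ ≤ max C 0 * ‖x - y‖ ^ β := fun x y =>
    (hgC x y).trans (by gcongr; exact le_max_left _ _)
  have hgu : UniformContinuous g := by
    refine HolderWith.uniformContinuous (C := (max C 0).toNNReal) (r := β.toNNReal)
      (fun x y => ?_) (Real.toNNReal_pos.2 hβ)
    rw [Real.coe_toNNReal β hβ.le, edist_dist, edist_dist, dist_eq_norm, dist_eq_norm,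
      ENNReal.ofReal_rpow_of_nonneg (norm_nonneg _) hβ.le]
    change _ ≤ ENNReal.ofReal _ * _
    rw [← ENNReal.ofReal_mul (le_max_right _ _)]
    exact ENNReal.ofReal_le_ofReal (hg x y)
  refine ⟨⟨g, hgu, ⟨B, hgB⟩, hgf⟩, fun g' hg' hg'f x => ?_⟩
  obtain rfl : g' = g := (hg'.ae_eq_iff_eq volume hgu.continuous).1 (hg'f.trans hgf.symm)
  exact hW.summable_norm_and_hasSum_wavelet j₀ (le_max_right _ _) hβ hg x
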